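/- Let $\mathbb{H}$ be a Hilbert space over $\mathbb{K}=\mathbb{R}$ or $\mathbb{C}$, and let $A$ be a nonzero bounded positive (self-adjoint with $\langle Ax,x\rangle\ge 0$ for all $x$) operator on $\mathbb{H}$. For $x\in\mathbb{H}$ put $\|x\|_A=\sqrt{\langle Ax,x\rangle}$. A bounded linear operator $T$ on $\mathbb{H}$ is called $A$-bounded if there is $c>0$ with $\|Tx\|_A\le c\|x\|_A$ for all $x\in\mathbb{H}$; in that case put $\|T\|_A=\sup\{\|Tx\|_A:\|x\|_A=1\}$ and $M_A(T)=\{x\in\mathbb{H}:\|x\|_A=1,\ \|Tx\|_A=\|T\|_A\}$. For $A$-bounded $T,S$ write $T\perp_A^B S$ if $\|T+\lambda S\|_A\ge\|T\|_A$ for all $\lambda\in\mathbb{K}$. An $A$-bounded operator $T$ with $\|T\|_A\ne 0$ is called $A$-smooth if, for all $A$-bounded $S_1,S_2$, $T\perp_A^B S_1$ and $T\perp_A^B S_2$ imply $T\perp_A^B (S_1+S_2)$. A bounded linear operator $T$ on $\mathbb{H}$ is called $A$-compact if for every sequence $(x_n)$ in $\mathbb{H}$ with $\sup_n\|x_n\|_A<\infty$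 there are a subsequence $(x_{n_k})$ and $y\in\mathbb{H}$ with $\|Tx_{n_k}-y\|_A\to 0$; such an operator is $A$-bounded. Theorem. Suppose that the range $R(A)$ is closed in $\mathbb{H}$, and let $T$ be a bounded linear operator on $\mathbb{H}$ that is $A$-compact and satisfies $\|T\|_A\neq 0$. Then the following are equivalent: (i) $T$ is $A$-smooth; (ii) there is $x_0\in\mathbb{H}$ with $\|x_0\|_A=1$ such that $M_A(T)\cap R(A)=\{\mu x_0:\mu\in\mathbb{K},\ |\mu|=1\}$. -/

import Mathlib

open Filter Topology

noncomputable section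

namespace SemiHilbert

variable {𝕜 H : Type*} [RCLike 𝕜] [NormedAddCommGroup H] [InnerProductSpace 𝕜 H]

/-- The semi-inner product `⟨x, y⟩_A = ⟨A x, y⟩`. It is linear in `x` and conjugate-linear in `y`;
Mathlib's `inner` is conjugate-linear in its first argument, hence the order of the arguments. -/
def aInner (A : H →L[𝕜] H) (x y : H) : 𝕜 :=
  inner 𝕜 y (A x)

/-- The semi-norm `‖x‖_A = √⟨x, x⟩_A` of a vector. For positive `A` the number `⟨x, x⟩_A` is real
and nonnegative. -/
def aNorm (A : H →L[𝕜] H) (x : H) : ℝ :=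
  √(RCLike.re (aInner A x x))

/-- `T` is `A`-bounded, i.e. it belongs to `𝔹_{A^{1/2}}(H)`: there is a constant `c > 0` with
`‖T x‖_A ≤ c ‖x‖_A` for all `x`. -/
def IsABounded (A T : H →L[𝕜] H) : Prop :=
  ∃ c : ℝ, 0 < c ∧ ∀ x : H, aNorm A (T x) ≤ c * aNorm A x

/-- The `A`-norm `‖T‖_A = sup {‖T x‖_A : ‖x‖_A = 1}` of an `A`-bounded operator. -/
def aOpNorm (A T : H →L[𝕜] H) : ℝ :=
  sSup {r : ℝ | ∃ x : H, aNorm A x = 1 ∧ r = aNorm A (T x)}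

/-- The `A`-norm attainment set `M_A(T) = {x : ‖x‖_A = 1, ‖T x‖_A = ‖T‖_A}`. -/
def normAttainmentSet (A T : H →L[𝕜] H) : Set H :=
  {x : H | aNorm A x = 1 ∧ aNorm A (T x) = aOpNorm A T}

/-- `A`-Birkhoff–James orthogonality `T ⊥_A^B S`: `‖T + λ S‖_A ≥ ‖T‖_A` for all scalars `λ`. -/
def ABirkhoffOrthogonal (A T S : H →L[𝕜] H) : Prop :=
  ∀ c : 𝕜, aOpNorm A T ≤ aOpNorm A (T + c • S)

/-- `T` is `A`-smooth: `T` is `A`-bounded with `‖T‖_A ≠ 0`, and `A`-Birkhoff–James orthogonality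
is right additive at `T` on the `A`-bounded operators. -/
def IsASmooth (A T : H →L[𝕜] H) : Prop :=
  IsABounded A T ∧ aOpNorm A T ≠ 0 ∧
    ∀ S₁ S₂ : H →L[𝕜] H, IsABounded A S₁ → IsABounded A S₂ →
      ABirkhoffOrthogonal A T S₁ → ABirkhoffOrthogonal A T S₂ →
        ABirkhoffOrthogonal A T (S₁ + S₂)

/-- `T` is `A`-compact: for every sequence `(x n)` bounded in `(H, ‖·‖_A)`, the sequence `(T (x n))`
has a subsequence that converges in `(H, ‖·‖_A)`. -/
def IsACompact (A T : H →L[𝕜] H) : Prop :=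
  ∀ x : ℕ → H, (∃ C : ℝ, ∀ n, aNorm A (x n) ≤ C) →
    ∃ (φ : ℕ → ℕ) (y : H), StrictMono φ ∧
      Tendsto (fun n => aNorm A (T (x (φ n)) - y)) atTop (𝓝 0)

end SemiHilbert

end

open Filter Topology

universe u

/-! Through `J` the `A`-norm becomes the norm of a semi-inner product space, so Cauchy–Schwarz and
the parallelogram law apply. Closedness of `R(A)` makes the two norms equivalent there, and `R(A)`
meets every class modulo `A`-null vectors. Hence maximizing sequences of an `A`-compact `T`
subconverge to a point of `M_A(T) ∩ R(A)`.

(ii) ⇒ (i): if `T` attains its norm only along `x₀`, then `T ⊥ S` forces `⟨T x₀, S x₀⟩_A = 0`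
(`inner_eq_zero_of_aBirkhoffOrthogonal`), a condition additive in `S` and sufficient for
orthogonality.

(i) ⇒ (ii): multiples of norm-attaining vectors form a subspace. A non-null `z` in it that is
`A`-orthogonal to `x₀` would make `T` orthogonal to a rank-one `S` and to `T - S`, but not to their
sum `T` (`norm_eq_zero_of_isASmooth`). -/

namespace SemiHilbert

variable {𝕜 H E : Type*} [RCLike 𝕜] [NormedAddCommGroup H] [InnerProductSpace 𝕜 H]
  [SeminormedAddCommGroup E] [InnerProductSpace 𝕜 E]

/-- A semi-inner product space carrying `⟨·, ·⟩_A`, so that `aNorm A` becomes an honest semi-norm. -/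
theorem exists_semiInnerModel {𝕜 : Type*} {H : Type u} [RCLike 𝕜] [NormedAddCommGroup H]
    [InnerProductSpace 𝕜 H] {A : H →L[𝕜] H} (hA : A.IsPositive) :
    ∃ (E : Type u) (_ : SeminormedAddCommGroup E) (_ : InnerProductSpace 𝕜 E) (J : H →ₗ[𝕜] E),
      ∀ x y, inner 𝕜 (J x) (J y) = inner 𝕜 x (A y) := by
  let core : PreInnerProductSpace.Core 𝕜 H :=
    { inner := fun x y => inner 𝕜 x (A y)
      conj_inner_symm := fun x y => by
        rw [inner_conj_symm]
        exact hA.1 x y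
      re_inner_nonneg := fun x => by
        rw [inner_re_symm]
        exact hA.2 x
      add_left := fun x y z => inner_add_left _ _ _
      smul_left := fun x y r => inner_smul_left _ _ _ }
  refine ⟨H, @InnerProductSpace.Core.toSeminormedAddCommGroup 𝕜 H _ _ _ core,
    InnerProductSpace.ofCore core, ?_⟩
  exact ⟨@LinearMap.id 𝕜 H _ _ _, fun x y => rfl⟩

/-! ### `A`-bounded and `A`-compact operators -/

section Model

variable {A T S : H →L[𝕜] H} {J : H →ₗ[𝕜] E}

theorem aNorm_eq (h : ∀ x y, inner 𝕜 (J x) (J y) = inner 𝕜 x (A y)) (x : H) :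
    aNorm A x = ‖J x‖ := by
  rw [aNorm, aInner, ← h, norm_eq_sqrt_re_inner (𝕜 := 𝕜)]

theorem isABounded_iff (h : ∀ x, aNorm A x = ‖J x‖) :
    IsABounded A T ↔ ∃ c : ℝ, 0 < c ∧ ∀ x, ‖J (T x)‖ ≤ c * ‖J x‖ := by
  simp only [IsABounded, h]

theorem IsABounded.bddAbove (hT : IsABounded A T) :
    BddAbove {r : ℝ | ∃ x : H, aNorm A x = 1 ∧ r = aNorm A (T x)} := by
  obtain ⟨c, -, hc⟩ := hT
  refine ⟨c, ?_⟩
  rintro r ⟨x, hx, rfl⟩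
  simpa [hx] using hc x

theorem aOpNorm_nonneg (A T : H →L[𝕜] H) : 0 ≤ aOpNorm A T := by
  refine Real.sSup_nonneg ?_
  rintro r ⟨x, -, rfl⟩
  exact Real.sqrt_nonneg _

theorem IsABounded.norm_le (h : ∀ x, aNorm A x = ‖J x‖) (hT : IsABounded A T) (x : H) :
    ‖J (T x)‖ ≤ aOpNorm A T * ‖J x‖ := by
  by_cases hx : ‖J x‖ = 0
  · obtain ⟨c, -, hc⟩ := (isABounded_iff h).1 hT
    simpa [hx] using hc x
  · have hpos : 0 < ‖J x‖ := lt_of_le_of_ne (norm_nonneg _) (Ne.symm hx)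
    have key : aNorm A (T (((‖J x‖⁻¹ : ℝ) : 𝕜) • x)) ≤ aOpNorm A T := by
      refine le_csSup hT.bddAbove ⟨_, ?_, rfl⟩
      rw [h, map_smul, norm_smul, RCLike.norm_ofReal, abs_of_pos (inv_pos.2 hpos),
        inv_mul_cancel₀ hx]
    rw [h, map_smul, map_smul, norm_smul, RCLike.norm_ofReal, abs_of_pos (inv_pos.2 hpos)] at key
    rwa [inv_mul_le_iff₀ hpos, mul_comm] at key

theorem IsABounded.add (h : ∀ x, aNorm A x = ‖J x‖) (hT : IsABounded A T)
    (hS : IsABounded A S) : IsABounded A (T + S) := by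
  rw [isABounded_iff h] at *
  obtain ⟨c, hc0, hc⟩ := hT
  obtain ⟨d, hd0, hd⟩ := hS
  refine ⟨c + d, by positivity, fun x => ?_⟩
  calc ‖J ((T + S) x)‖ = ‖J (T x) + J (S x)‖ := by simp
    _ ≤ ‖J (T x)‖ + ‖J (S x)‖ := norm_add_le _ _
    _ ≤ c * ‖J x‖ + d * ‖J x‖ := add_le_add (hc x) (hd x)
    _ = (c + d) * ‖J x‖ := by ring

theorem IsABounded.smul (h : ∀ x, aNorm A x = ‖J x‖) (hS : IsABounded A S) (a : 𝕜) :
    IsABounded A (a • S) := by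
  rw [isABounded_iff h] at *
  obtain ⟨d, hd0, hd⟩ := hS
  refine ⟨(‖a‖ + 1) * d, by positivity, fun x => ?_⟩
  calc ‖J ((a • S) x)‖ = ‖a‖ * ‖J (S x)‖ := by simp [norm_smul]
    _ ≤ (‖a‖ + 1) * (d * ‖J x‖) :=
      mul_le_mul (by linarith) (hd x) (norm_nonneg _) (by positivity)
    _ = (‖a‖ + 1) * d * ‖J x‖ := by ring

theorem IsACompact.isABounded (h : ∀ x, aNorm A x = ‖J x‖) (hT : IsACompact A T) :
    IsABounded A T := by
  rw [isABounded_iff h]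
  by_contra! hcon
  have hseq : ∀ n : ℕ, ∃ x : H, ‖J x‖ ≤ 1 ∧ (n : ℝ) ≤ ‖J (T x)‖ := by
    intro n
    obtain ⟨x, hx⟩ := hcon (n + 1) (by positivity)
    have hTx : 0 < ‖J (T x)‖ := lt_of_le_of_lt (by positivity) hx
    have hn : (0 : ℝ) < n + 1 := by positivity
    -- Normalizing by the image rather than by `x` also covers `‖J x‖ = 0`.
    refine ⟨((((n + 1 : ℝ) * ‖J (T x)‖⁻¹ : ℝ)) : 𝕜) • x, ?_, ?_⟩
    · rw [map_smul, norm_smul, RCLike.norm_ofReal, abs_of_pos (by positivity), mul_right_comm,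
        ← div_eq_mul_inv, div_le_one hTx]
      exact hx.le
    · rw [map_smul, map_smul, norm_smul, RCLike.norm_ofReal, abs_of_pos (by positivity),
        mul_assoc, inv_mul_cancel₀ hTx.ne']
      linarith
  choose x hx1 hx2 using hseq
  obtain ⟨φ, y, hφ, hlim⟩ := hT x ⟨1, fun n => by rw [h]; exact hx1 n⟩
  have hev : ∀ᶠ n in atTop, aNorm A (T (x (φ n)) - y) < 1 := hlim.eventually_lt_const one_pos
  obtain ⟨m, hm⟩ := exists_nat_gt (1 + ‖J y‖)
  obtain ⟨n, hn1, hn2⟩ := (hev.and (eventually_ge_atTop m)).exists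
  rw [h, map_sub] at hn1
  have h1 : (m : ℝ) ≤ φ n := by exact_mod_cast hn2.trans (hφ.id_le n)
  have h2 := hx2 (φ n)
  have h3 := norm_sub_norm_le (J (T (x (φ n)))) (J y)
  linarith

theorem exists_aNorm_eq_one (hT0 : aOpNorm A T ≠ 0) : ∃ x, aNorm A x = 1 := by
  by_contra! hcon
  -- Without unit vectors the supremum is `sSup ∅ = 0`.
  exact hT0 (by simp [aOpNorm, hcon])

theorem exists_lt_aNorm_apply (h1 : ∃ x, aNorm A x = 1) {r : ℝ} (hr : r < aOpNorm A T) :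
    ∃ x, aNorm A x = 1 ∧ r < aNorm A (T x) := by
  obtain ⟨x₁, hx₁⟩ := h1
  obtain ⟨_, ⟨x, hx, rfl⟩, hlt⟩ := exists_lt_of_lt_csSup
    (s := {r : ℝ | ∃ x : H, aNorm A x = 1 ∧ r = aNorm A (T x)}) ⟨_, x₁, hx₁, rfl⟩ hr
  exact ⟨x, hx, hlt⟩

theorem norm_model_le (h : ∀ x y, inner 𝕜 (J x) (J y) = inner 𝕜 x (A y)) (x : H) :
    ‖J x‖ ≤ √‖A‖ * ‖x‖ := by
  refine le_of_sq_le_sq ?_ (by positivity)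
  rw [mul_pow, Real.sq_sqrt (norm_nonneg _), ← inner_self_eq_norm_sq (𝕜 := 𝕜), h]
  calc RCLike.re (inner 𝕜 x (A x)) ≤ ‖x‖ * ‖A x‖ := re_inner_le_norm _ _
    _ ≤ ‖x‖ * (‖A‖ * ‖x‖) := by gcongr; exact A.le_opNorm x
    _ = ‖A‖ * ‖x‖ ^ 2 := by ring

/-! ### Closed range, completeness and norm attainment -/

section Complete

variable [CompleteSpace H]

/-- On a closed range of `A` the norm is dominated by the `A`-norm. -/
theorem exists_norm_le_model (h : ∀ x y, inner 𝕜 (J x) (J y) = inner 𝕜 x (A y))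
    (hR : IsClosed (Set.range A)) :
    ∃ C : ℝ, ∀ y ∈ Set.range A, ‖y‖ ≤ C * ‖J y‖ := by
  have hR' : IsClosed (A.range : Set H) := hR
  have : CompleteSpace A.range := hR'.completeSpace_coe
  -- Open mapping: `y = A z` with `‖z‖ ≤ C ‖y‖`. Then `‖y‖² = ⟨y, z⟩_A`, and Cauchy–Schwarz for the
  -- `A`-product gives the bound.
  obtain ⟨C, hC0, hC⟩ := ContinuousLinearMap.exists_preimage_norm_le A.rangeRestrict
    (by
      rintro ⟨_, x, rfl⟩
      exact ⟨x, rfl⟩)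
  refine ⟨√‖A‖ * C, fun y hy => ?_⟩
  obtain ⟨z, hz, hzn⟩ := hC ⟨y, hy⟩
  replace hz : A z = y := congrArg Subtype.val hz
  replace hzn : ‖z‖ ≤ C * ‖y‖ := hzn
  by_cases hy0 : ‖y‖ = 0
  · rw [hy0]; positivity
  have hypos : 0 < ‖y‖ := lt_of_le_of_ne (norm_nonneg _) (Ne.symm hy0)
  refine le_of_mul_le_mul_right ?_ hypos
  calc ‖y‖ * ‖y‖ = ‖(inner 𝕜 y (A z) : 𝕜)‖ := by
        rw [hz, inner_self_eq_norm_sq_to_K]; simp [sq]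
    _ = ‖(inner 𝕜 (J y) (J z) : 𝕜)‖ := by rw [h]
    _ ≤ ‖J y‖ * ‖J z‖ := norm_inner_le_norm _ _
    _ ≤ ‖J y‖ * (√‖A‖ * (C * ‖y‖)) := by
        gcongr
        exact (norm_model_le h z).trans (by gcongr)
    _ = √‖A‖ * C * ‖J y‖ * ‖y‖ := by ring

/-- Take the orthogonal projection `y` of `x` onto `R(A)`: since `A` is self-adjoint, `x - y` lies
in `ker A`. -/
theorem exists_mem_range_norm_sub_eq_zero (h : ∀ x y, inner 𝕜 (J x) (J y) = inner 𝕜 x (A y))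
    (hR : IsClosed (Set.range A)) (hA : A.IsPositive) (x : H) :
    ∃ y ∈ Set.range A, ‖J x - J y‖ = 0 := by
  have hR' : IsClosed (A.range : Set H) := hR
  have : CompleteSpace A.range := hR'.completeSpace_coe
  obtain ⟨y, hy, hxy⟩ := A.range.exists_norm_eq_iInf_of_complete_subspace hR'.isComplete x
  replace hxy := (A.range.norm_eq_iInf_iff_inner_eq_zero hy).1 hxy
  refine ⟨y, hy, ?_⟩
  have h0 : A (x - y) = 0 := by
    rw [← inner_self_eq_zero (𝕜 := 𝕜)]
    have := hxy (A (A (x - y))) ⟨_, rfl⟩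
    rwa [← show inner 𝕜 (A (x - y)) (A (x - y)) = inner 𝕜 (x - y) (A (A (x - y))) from
      hA.1 _ _] at this
  rw [← map_sub, ← sq_eq_zero_iff, ← inner_self_eq_norm_sq (𝕜 := 𝕜), h, h0]
  simp

/-- The range of `A`, when closed, is complete for the `A`-norm. -/
theorem exists_tendsto_model_of_cauchySeq
    (h : ∀ x y, inner 𝕜 (J x) (J y) = inner 𝕜 x (A y))
    (hR : IsClosed (Set.range A)) (hA : A.IsPositive) {u : ℕ → H}
    (hu : CauchySeq fun n => J (u n)) :
    ∃ x ∈ Set.range A, Tendsto (fun n => J (u n)) atTop (𝓝 (J x)) := by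
  choose v hvR hv using fun n => exists_mem_range_norm_sub_eq_zero h hR hA (u n)
  obtain ⟨C, hC⟩ := exists_norm_le_model h hR
  have hdist : ∀ m n, dist (J (v m)) (J (v n)) = dist (J (u m)) (J (u n)) := by
    intro m n
    have e : ∀ k, dist (J (u k)) (J (v k)) = 0 := fun k => by rw [dist_eq_norm, hv k]
    refine le_antisymm ?_ ?_
    · linarith [dist_triangle4 (J (v m)) (J (u m)) (J (u n)) (J (v n)), e m, e n,
        dist_comm (J (v m)) (J (u m))]
    · linarith [dist_triangle4 (J (u m)) (J (v m)) (J (v n)) (J (u n)), e m, e n,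
        dist_comm (J (v n)) (J (u n))]
  have hvC : CauchySeq v := by
    rw [Metric.cauchySeq_iff'] at hu ⊢
    intro ε hε
    obtain ⟨N, hN⟩ := hu (ε / (|C| + 1)) (by positivity)
    refine ⟨N, fun n hn => ?_⟩
    have hmem : v n - v N ∈ Set.range A := by
      obtain ⟨a, ha⟩ := hvR n
      obtain ⟨b, hb⟩ := hvR N
      exact ⟨a - b, by rw [map_sub, ha, hb]⟩
    have h1 := hC _ hmem
    have h2 := hN n hn
    rw [← hdist, dist_eq_norm, ← map_sub, lt_div_iff₀ (by positivity)] at h2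
    rw [dist_eq_norm]
    have h3 : C * ‖J (v n - v N)‖ ≤ |C| * ‖J (v n - v N)‖ := by gcongr; exact le_abs_self C
    nlinarith [norm_nonneg (J (v n - v N))]
  obtain ⟨x, hx⟩ := cauchySeq_tendsto_of_complete hvC
  refine ⟨x, hR.mem_of_tendsto hx (Eventually.of_forall hvR), ?_⟩
  rw [tendsto_iff_norm_sub_tendsto_zero] at hx ⊢
  refine squeeze_zero (fun _ => norm_nonneg _) (fun n => ?_)
    (by simpa using hx.const_mul (√‖A‖))
  calc ‖J (u n) - J x‖ ≤ ‖J (u n) - J (v n)‖ + ‖J (v n) - J x‖ := norm_sub_le_norm_sub_add_norm_sub _ _ _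
    _ = ‖J (v n - x)‖ := by rw [hv, zero_add, map_sub]
    _ ≤ √‖A‖ * ‖v n - x‖ := norm_model_le h _

/-- A maximizing sequence of an `A`-compact operator has a subsequence that converges in `A`-norm. -/
theorem exists_subseq_tendsto_of_maximizing
    (h : ∀ x y, inner 𝕜 (J x) (J y) = inner 𝕜 x (A y))
    (hR : IsClosed (Set.range A)) (hA : A.IsPositive) (hT : IsACompact A T)
    (hT0 : aOpNorm A T ≠ 0) {u : ℕ → H} (hu : ∀ n, ‖J (u n)‖ = 1)
    (hmax : Tendsto (fun n => ‖J (T (u n))‖) atTop (𝓝 (aOpNorm A T))) :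
    ∃ φ : ℕ → ℕ, StrictMono φ ∧ ∃ x ∈ normAttainmentSet A T ∩ Set.range A,
      Tendsto (fun n => J (u (φ n))) atTop (𝓝 (J x)) ∧
      Tendsto (fun n => J (T (u (φ n)))) atTop (𝓝 (J (T x))) := by
  have hn := aNorm_eq h
  have hTb := hT.isABounded hn
  obtain ⟨φ, y, hφ, hy⟩ := hT u ⟨1, fun n => by rw [hn, hu]⟩
  have hy' : Tendsto (fun n => J (T (u (φ n)))) atTop (𝓝 (J y)) := by
    rw [tendsto_iff_norm_sub_tendsto_zero]
    simpa only [hn, map_sub] using hy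
  have hNpos : 0 < aOpNorm A T := lt_of_le_of_ne (aOpNorm_nonneg A T) (Ne.symm hT0)
  have hNy : ‖J y‖ = aOpNorm A T :=
    tendsto_nhds_unique hy'.norm (hmax.comp hφ.tendsto_atTop)
  have hsum : Tendsto (fun p : ℕ × ℕ => ‖J (T (u (φ p.1))) + J (T (u (φ p.2)))‖) atTop
      (𝓝 (2 * aOpNorm A T)) := by
    have e : 2 * aOpNorm A T = ‖J y + J y‖ := by
      rw [← two_smul 𝕜 (J y), norm_smul, hNy]; simp
    rw [e, ← prod_atTop_atTop_eq]
    exact ((hy'.comp tendsto_fst).add (hy'.comp tendsto_snd)).norm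
  -- For unit vectors the parallelogram law gives `‖x - y‖² = 4 - ‖x + y‖²`, and `‖x + y‖ ≥ ‖T (x +
  -- y)‖_A / ‖T‖_A`, which tends to `2`.
  have hCauchy : CauchySeq fun n => J (u (φ n)) := by
    rw [cauchySeq_iff_tendsto_dist_atTop_0]
    have hsq : Tendsto (fun p : ℕ × ℕ => √(4 -
        (‖J (T (u (φ p.1))) + J (T (u (φ p.2)))‖ / aOpNorm A T) ^ 2)) atTop (𝓝 0) := by
      have := ((hsum.div_const (aOpNorm A T)).pow 2).const_sub 4
      rw [mul_div_cancel_right₀ _ hT0] at this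
      norm_num at this
      simpa using this.sqrt
    refine squeeze_zero (fun _ => dist_nonneg) (fun p => Real.le_sqrt_of_sq_le ?_) hsq
    have hpar := parallelogram_law_with_norm 𝕜 (J (u (φ p.1))) (J (u (φ p.2)))
    have hle := hTb.norm_le hn (u (φ p.1) + u (φ p.2))
    rw [map_add, map_add, map_add, ← div_le_iff₀' hNpos] at hle
    have hle2 := pow_le_pow_left₀ (by positivity) hle 2
    rw [hu, hu] at hpar
    rw [dist_eq_norm]
    nlinarith
  obtain ⟨x, hxR, hx⟩ := exists_tendsto_model_of_cauchySeq h hR hA (u := fun n => u (φ n)) hCauchy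
  have hTx : Tendsto (fun n => J (T (u (φ n)))) atTop (𝓝 (J (T x))) := by
    rw [tendsto_iff_norm_sub_tendsto_zero] at hx ⊢
    refine squeeze_zero (fun _ => norm_nonneg _) (fun n => ?_)
      (by simpa using hx.const_mul (aOpNorm A T))
    simpa only [map_sub] using hTb.norm_le hn (u (φ n) - x)
  refine ⟨φ, hφ, x, ⟨⟨?_, ?_⟩, hxR⟩, hx, hTx⟩
  · rw [hn]
    exact tendsto_nhds_unique hx.norm (by simp [hu])
  · rw [hn]
    exact tendsto_nhds_unique hTx.norm (hmax.comp hφ.tendsto_atTop)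

theorem exists_mem_normAttainmentSet_inter_range
    (h : ∀ x y, inner 𝕜 (J x) (J y) = inner 𝕜 x (A y))
    (hR : IsClosed (Set.range A)) (hA : A.IsPositive) (hT : IsACompact A T)
    (hT0 : aOpNorm A T ≠ 0) : (normAttainmentSet A T ∩ Set.range A).Nonempty := by
  obtain ⟨x₁, hx₁⟩ := exists_aNorm_eq_one hT0
  have hn := aNorm_eq h
  obtain ⟨r, -, hr, hmem⟩ := exists_seq_tendsto_sSup
    (S := {r : ℝ | ∃ x : H, aNorm A x = 1 ∧ r = aNorm A (T x)}) ⟨_, x₁, hx₁, rfl⟩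
    (hT.isABounded hn).bddAbove
  choose u hu1 hu2 using hmem
  obtain ⟨-, -, x, hx, -⟩ := exists_subseq_tendsto_of_maximizing h hR hA hT hT0
    (fun n => by rw [← hn, hu1 n]) (hr.congr fun n => by rw [hu2 n, hn])
  exact ⟨x, hx⟩

end Complete

/-! ### Birkhoff–James orthogonality and norm-attaining vectors -/

/-- Pythagoras at `x`: adding `c • S x` to `T x` cannot shorten it. -/
theorem aBirkhoffOrthogonal_of_inner_eq_zero (h : ∀ x, aNorm A x = ‖J x‖)
    (hT : IsABounded A T) (hS : IsABounded A S) {x : H} (hx : x ∈ normAttainmentSet A T)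
    (h0 : inner 𝕜 (J (T x)) (J (S x)) = (0 : 𝕜)) : ABirkhoffOrthogonal A T S := by
  intro c
  rw [← hx.2]
  refine le_trans ?_ (le_csSup (hT.add h (hS.smul h c)).bddAbove ⟨x, hx.1, rfl⟩)
  rw [h, h]
  refine le_of_sq_le_sq ?_ (norm_nonneg _)
  have e : J ((T + c • S) x) = J (T x) + c • J (S x) := by simp
  rw [e, norm_add_sq (𝕜 := 𝕜), inner_smul_right, h0]
  simp

/-- If `T ⊥_A^B S` and `T` attains its `A`-norm only along `x₀`, then `⟨T x₀, S x₀⟩_A = 0`. -/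
theorem inner_eq_zero_of_aBirkhoffOrthogonal [CompleteSpace H]
    (h : ∀ x y, inner 𝕜 (J x) (J y) = inner 𝕜 x (A y))
    (hR : IsClosed (Set.range A)) (hA : A.IsPositive) (hT : IsACompact A T)
    (hT0 : aOpNorm A T ≠ 0) (hS : IsABounded A S) {x₀ : H}
    (hx₀ : normAttainmentSet A T ∩ Set.range A ⊆ {x : H | ∃ μ : 𝕜, ‖μ‖ = 1 ∧ x = μ • x₀})
    (horth : ABirkhoffOrthogonal A T S) : inner 𝕜 (J (T x₀)) (J (S x₀)) = (0 : 𝕜) := by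
  have hn := aNorm_eq h
  have hTb := hT.isABounded hn
  set w : 𝕜 := inner 𝕜 (J (T x₀)) (J (S x₀)) with hw
  -- This phase turns the inner product into `⟨T x₀, R x₀⟩ = -‖w‖²`; the limit argument shows its
  -- real part is nonnegative, so `w = 0`.
  set c : 𝕜 := -starRingEnd 𝕜 w with hc
  set R : H →L[𝕜] H := c • S with hRdef
  have hRb : IsABounded A R := hS.smul hn c
  set N := aOpNorm A T with hN
  set K := aOpNorm A R with hK
  have hN0 : 0 ≤ N := aOpNorm_nonneg A T
  have hK0 : 0 ≤ K := aOpNorm_nonneg A R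
  let t : ℕ → ℝ := fun n => 1 / ((n : ℝ) + 1)
  have ht : Tendsto t atTop (𝓝 0) := tendsto_one_div_add_atTop_nhds_zero_nat
  have htpos : ∀ n, 0 < t n := fun n => by positivity
  -- The error `t²` is `o(t)`, so it disappears once the squared inequality is divided by `t`.
  have hex : ∀ n, ∃ x, ‖J x‖ = 1 ∧ N - t n ^ 2 < ‖J (T x) + ((t n : ℝ) : 𝕜) • J (R x)‖ := by
    intro n
    obtain ⟨x, hx1, hx2⟩ := exists_lt_aNorm_apply (T := T + (((t n : ℝ) : 𝕜) * c) • S)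
      (exists_aNorm_eq_one hT0)
      (lt_of_lt_of_le (sub_lt_self N (pow_pos (htpos n) 2)) (horth _))
    refine ⟨x, by rw [← hn, hx1], ?_⟩
    rw [hn] at hx2
    simpa [hRdef, mul_smul] using hx2
  choose u hu1 hu2 using hex
  have hTu : ∀ n, ‖J (T (u n))‖ ≤ N := fun n => by simpa [hu1] using hTb.norm_le hn (u n)
  have hRu : ∀ n, ‖J (R (u n))‖ ≤ K := fun n => by simpa [hu1] using hRb.norm_le hn (u n)
  have hsm : ∀ n, ‖((t n : ℝ) : 𝕜) • J (R (u n))‖ = t n * ‖J (R (u n))‖ := fun n => by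
    rw [norm_smul, RCLike.norm_ofReal, abs_of_pos (htpos n)]
  have hmax : Tendsto (fun n => ‖J (T (u n))‖) atTop (𝓝 N) := by
    have hlow : Tendsto (fun n => N - t n ^ 2 - t n * K) atTop (𝓝 N) := by
      simpa using ((ht.pow 2).const_sub N).sub (ht.mul_const K)
    refine tendsto_of_tendsto_of_tendsto_of_le_of_le hlow tendsto_const_nhds (fun n => ?_) hTu
    have h1 := norm_add_le (J (T (u n))) (((t n : ℝ) : 𝕜) • J (R (u n)))
    have h2 := hu2 n
    have h3 := mul_le_mul_of_nonneg_left (hRu n) (htpos n).le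
    rw [hsm] at h1
    simp only
    linarith
  obtain ⟨φ, hφ, x, hx, hux, hTux⟩ :=
    exists_subseq_tendsto_of_maximizing h hR hA hT hT0 hu1 hmax
  have hRux : Tendsto (fun n => J (R (u (φ n)))) atTop (𝓝 (J (R x))) := by
    rw [tendsto_iff_norm_sub_tendsto_zero] at hux ⊢
    refine squeeze_zero (fun _ => norm_nonneg _) (fun n => ?_)
      (by simpa using hux.const_mul K)
    simpa only [map_sub] using hRb.norm_le hn (u (φ n) - x)
  have hlower : ∀ n, -(t n * (K ^ 2 + 2 * N)) ≤
      2 * RCLike.re (inner 𝕜 (J (T (u n))) (J (R (u n))) : 𝕜) := by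
    intro n
    have h1 := norm_add_sq (𝕜 := 𝕜) (J (T (u n))) (((t n : ℝ) : 𝕜) • J (R (u n)))
    rw [hsm, inner_smul_right, RCLike.re_ofReal_mul] at h1
    have h2 : N ^ 2 - 2 * N * t n ^ 2 ≤
        ‖J (T (u n)) + ((t n : ℝ) : 𝕜) • J (R (u n))‖ ^ 2 := by
      -- Squaring needs a nonnegative left side; otherwise `N ≤ t²` and the bound is trivial.
      rcases le_total 0 (N - t n ^ 2) with hs | hs
      · have := pow_le_pow_left₀ hs (hu2 n).le 2
        nlinarith [sq_nonneg (t n ^ 2)]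
      · have : N ^ 2 - 2 * N * t n ^ 2 ≤ 0 := by nlinarith [sq_nonneg (t n)]
        exact this.trans (sq_nonneg _)
    have h3 := pow_le_pow_left₀ (norm_nonneg _) (hTu n) 2
    have h4 := pow_le_pow_left₀ (norm_nonneg _) (hRu n) 2
    have h5 := mul_le_mul_of_nonneg_left h4 (sq_nonneg (t n))
    refine le_of_mul_le_mul_left ?_ (htpos n)
    rw [h1] at h2
    nlinarith
  have hlim : 0 ≤ 2 * RCLike.re (inner 𝕜 (J (T x)) (J (R x)) : 𝕜) := by
    refine le_of_tendsto_of_tendsto' ?_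
      ((RCLike.continuous_re.tendsto _).comp (hTux.inner hRux) |>.const_mul 2)
      (fun n => hlower (φ n))
    simpa using ((ht.comp hφ.tendsto_atTop).mul_const (K ^ 2 + 2 * N)).neg
  obtain ⟨μ, hμ, rfl⟩ := hx₀ hx
  have e : (inner 𝕜 (J (T (μ • x₀))) (J (R (μ • x₀))) : 𝕜) = -((‖w‖ ^ 2 : ℝ) : 𝕜) := by
    have hμ2 : starRingEnd 𝕜 μ * μ = 1 := by rw [RCLike.conj_mul, hμ]; simp
    have hw2 : starRingEnd 𝕜 w * w = ((‖w‖ ^ 2 : ℝ) : 𝕜) := by rw [RCLike.conj_mul]; simp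
    simp only [hRdef, smul_apply, map_smul, inner_smul_left,
      inner_smul_right, ← hw, hc]
    rw [← hw2]
    linear_combination (-starRingEnd 𝕜 w * w) * hμ2
  rw [e, map_neg, RCLike.ofReal_re] at hlim
  have : ‖w‖ ^ 2 = 0 := le_antisymm (by linarith) (sq_nonneg _)
  simpa using this

/-- The vectors at which `T` attains its `A`-norm span a subspace. -/
theorem norm_apply_sub_smul_of_maximal (h : ∀ x, aNorm A x = ‖J x‖) (hT : IsABounded A T)
    {x y : H} (hx : ‖J (T x)‖ = aOpNorm A T * ‖J x‖) (hy : ‖J (T y)‖ = aOpNorm A T * ‖J y‖)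
    (a : 𝕜) : ‖J (T (x - a • y))‖ = aOpNorm A T * ‖J (x - a • y)‖ := by
  have hN0 : 0 ≤ aOpNorm A T := aOpNorm_nonneg A T
  have hz : ‖J (T (a • y))‖ = aOpNorm A T * ‖J (a • y)‖ := by
    simp only [map_smul, norm_smul, hy]; ring
  generalize a • y = z at hz ⊢
  -- The two parallelogram laws give equality for the sum of the squares at `x + z` and `x - z`; the
  -- upper bound at `x + z` then forces the lower bound at `x - z`.
  refine le_antisymm (hT.norm_le h _) (le_of_sq_le_sq ?_ (norm_nonneg _))
  have h1 := parallelogram_law_with_norm 𝕜 (J (T x)) (J (T z))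
  have h2 := parallelogram_law_with_norm 𝕜 (J x) (J z)
  have h3 := pow_le_pow_left₀ (norm_nonneg _) (hT.norm_le h (x + z)) 2
  simp only [map_add, map_sub] at h3 ⊢
  rw [hx, hz] at h1
  rw [mul_pow] at h3 ⊢
  have h4 := congrArg (fun r => aOpNorm A T ^ 2 * r) h2
  nlinarith

/-- With `S = ⟨·, x₀⟩_A T x₀`, `S` vanishes at `z` and `T - S` vanishes at `x₀`. If `z` were not
null, both points would attain the norm up to scaling, so `T` would be orthogonal to both operators.
-/
theorem norm_eq_zero_of_isASmooth
    (h : ∀ x y, inner 𝕜 (J x) (J y) = inner 𝕜 x (A y)) (hA : A.IsPositive)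
    (hsm : IsASmooth A T) {x₀ z : H} (hx₀ : x₀ ∈ normAttainmentSet A T)
    (hz : ‖J (T z)‖ = aOpNorm A T * ‖J z‖) (horth : inner 𝕜 (J x₀) (J z) = (0 : 𝕜)) :
    ‖J z‖ = 0 := by
  by_contra hz0
  have hn := aNorm_eq h
  obtain ⟨hTb, hT0, hadd⟩ := hsm
  have hN0 : 0 < aOpNorm A T := lt_of_le_of_ne (aOpNorm_nonneg A T) (Ne.symm hT0)
  have hx1 : ‖J x₀‖ = 1 := by rw [← hn, hx₀.1]
  let S : H →L[𝕜] H := (innerSL 𝕜 (A x₀)).smulRight (T x₀)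
  have hSx : ∀ x, S x = (inner 𝕜 (J x₀) (J x) : 𝕜) • T x₀ := fun x => by
    rw [h, ← show inner 𝕜 (A x₀) x = inner 𝕜 x₀ (A x) from hA.1 _ _]; rfl
  have hSb : IsABounded A S := by
    rw [isABounded_iff hn]
    refine ⟨aOpNorm A T, hN0, fun x => ?_⟩
    rw [hSx, map_smul, norm_smul, ← hn (T x₀), hx₀.2, mul_comm]
    gcongr
    simpa [hx1] using norm_inner_le_norm (𝕜 := 𝕜) (J x₀) (J x)
  have hS'b : IsABounded A (T + (-1 : 𝕜) • S) := hTb.add hn (hSb.smul hn _)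
  have hzpos : 0 < ‖J z‖ := lt_of_le_of_ne (norm_nonneg _) (Ne.symm hz0)
  have hmem : (((‖J z‖⁻¹ : ℝ) : 𝕜) • z) ∈ normAttainmentSet A T := by
    constructor
    · rw [hn, map_smul, norm_smul, RCLike.norm_ofReal, abs_of_pos (inv_pos.2 hzpos),
        inv_mul_cancel₀ hz0]
    · rw [hn, map_smul, map_smul, norm_smul, RCLike.norm_ofReal, abs_of_pos (inv_pos.2 hzpos), hz]
      field_simp
  have h1 : ABirkhoffOrthogonal A T S := by
    refine aBirkhoffOrthogonal_of_inner_eq_zero hn hTb hSb hmem ?_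
    have e : inner 𝕜 (J x₀) (J (((‖J z‖⁻¹ : ℝ) : 𝕜) • z)) = (0 : 𝕜) := by
      rw [map_smul, inner_smul_right, horth, mul_zero]
    rw [hSx, e, zero_smul, map_zero, inner_zero_right]
  have h2 : ABirkhoffOrthogonal A T (T + (-1 : 𝕜) • S) := by
    refine aBirkhoffOrthogonal_of_inner_eq_zero hn hTb hS'b hx₀ ?_
    have : (T + (-1 : 𝕜) • S) x₀ = 0 := by
      simp [hSx, inner_self_eq_norm_sq_to_K, hx1]
    rw [this]
    simp
  -- The scalar `-1` cancels `T` against `S + (T - S) = T`, leaving `‖T‖_A ≤ 0`.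
  have h3 := hadd _ _ hSb hS'b h1 h2 (-1)
  have e : T + (-1 : 𝕜) • (S + (T + (-1 : 𝕜) • S)) = 0 := by
    ext x; simp
  have e0 : aOpNorm A (0 : H →L[𝕜] H) ≤ 0 := by
    refine Real.sSup_nonpos ?_
    rintro r ⟨x, -, rfl⟩
    simp [hn]
  rw [e] at h3
  linarith

end Model

end SemiHilbert

/-! ### The equivalence -/

theorem mainTheorem3 {𝕜 H : Type*} [RCLike 𝕜] [NormedAddCommGroup H] [InnerProductSpace 𝕜 H]
    [CompleteSpace H] (A T : H →L[𝕜] H) (hA : A.IsPositive) (hA0 : A ≠ 0)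
    (hR : IsClosed (Set.range A)) (hT : SemiHilbert.IsACompact A T)
    (hT0 : SemiHilbert.aOpNorm A T ≠ 0) :
    SemiHilbert.IsASmooth A T ↔
      ∃ x₀ : H, SemiHilbert.aNorm A x₀ = 1 ∧
        SemiHilbert.normAttainmentSet A T ∩ Set.range A = {x : H | ∃ μ : 𝕜, ‖μ‖ = 1 ∧ x = μ • x₀} := by
  obtain ⟨E, _, _, J, h⟩ := SemiHilbert.exists_semiInnerModel hA
  have hn := SemiHilbert.aNorm_eq h
  have hTb := hT.isABounded hn
  constructor
  · intro hsm
    obtain ⟨x₀, hx₀, hx₀R⟩ :=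
      SemiHilbert.exists_mem_normAttainmentSet_inter_range h hR hA hT hT0
    have hmaxi : ∀ x ∈ SemiHilbert.normAttainmentSet A T,
        ‖J (T x)‖ = SemiHilbert.aOpNorm A T * ‖J x‖ := fun x hx => by
      rw [← hn, ← hn, hx.1, hx.2, mul_one]
    have hx1 : ‖J x₀‖ = 1 := by rw [← hn, hx₀.1]
    refine ⟨x₀, hx₀.1, Set.Subset.antisymm ?_ ?_⟩
    · rintro x ⟨hx, hxR⟩
      -- Gram–Schmidt coefficient: `x - a • x₀` is `A`-orthogonal to `x₀`, hence `A`-null. As it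
      -- lies in `R(A)`, it is zero.
      set a : 𝕜 := inner 𝕜 (J x₀) (J x) with ha
      have hz := SemiHilbert.norm_eq_zero_of_isASmooth h hA hsm hx₀
        (SemiHilbert.norm_apply_sub_smul_of_maximal hn hTb (hmaxi x hx) (hmaxi x₀ hx₀) a)
        (by rw [map_sub, map_smul, inner_sub_right, inner_smul_right,
              inner_self_eq_norm_sq_to_K, hx1, ← ha]; simp)
      obtain ⟨C, hC⟩ := SemiHilbert.exists_norm_le_model h hR
      have hle := hC (x - a • x₀) (by
        obtain ⟨b, rfl⟩ := hxR
        obtain ⟨d, rfl⟩ := hx₀R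
        exact ⟨b - a • d, by simp⟩)
      rw [hz, mul_zero, norm_le_zero_iff, sub_eq_zero] at hle
      refine ⟨a, ?_, hle⟩
      have h1 := hx.1
      rw [hn, hle, map_smul, norm_smul, hx1, mul_one] at h1
      exact h1
    · rintro _ ⟨μ, hμ, rfl⟩
      refine ⟨⟨?_, ?_⟩, ?_⟩
      · rw [hn, map_smul, norm_smul, hμ, hx1, one_mul]
      · rw [hn, map_smul, map_smul, norm_smul, hμ, one_mul, ← hn, hx₀.2]
      · obtain ⟨d, rfl⟩ := hx₀R
        exact ⟨μ • d, by simp⟩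
  · rintro ⟨x₀, -, hset⟩
    have hx₀ : x₀ ∈ SemiHilbert.normAttainmentSet A T := by
      have : x₀ ∈ SemiHilbert.normAttainmentSet A T ∩ Set.range A := by
        rw [hset]
        exact ⟨1, by simp, by simp⟩
      exact this.1
    refine ⟨hTb, hT0, fun S₁ S₂ hS₁ hS₂ h₁ h₂ => ?_⟩
    refine SemiHilbert.aBirkhoffOrthogonal_of_inner_eq_zero hn hTb (hS₁.add hn hS₂) hx₀ ?_
    have e₁ := SemiHilbert.inner_eq_zero_of_aBirkhoffOrthogonal h hR hA hT hT0 hS₁ hset.subset h₁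
    have e₂ := SemiHilbert.inner_eq_zero_of_aBirkhoffOrthogonal h hR hA hT hT0 hS₂ hset.subset h₂
    rw [add_apply, map_add, inner_add_right, e₁, e₂, add_zero]
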